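/- Let $n\ge 0$, let $\mathbb{M}_n$ be the algebra of complex $n\times n$ matrices, let $\mathcal{G}$ be a compact Lie group and let $U:\mathcal{G}\to\mathbb{M}_n$ be a (continuous) unitary representation. A linear map $\phi:\mathbb{M}_n\to\mathbb{M}_n$ is completely positive if for every $k$ the entrywise extension $[a_{ij}]\mapsto[\phi(a_{ij})]$ to $\mathbb{M}_k(\mathbb{M}_n)$ is positive; it is completely copositive if its composition $\tau\circ\phi$ with the matrix transposition $\tau$ is completely positive; it is decomposable if it is the sum of a completely positive and a completely copositive map; it is $U$-covariant if $\phi(U(g)AU(g)^{*})=U(g)\phi(A)U(g)^{*}$ for all $g\in\mathcal{G}$ and $A\in\mathbb{M}_n$. Let $\phi^{\star}$ be the dual of $\phi$, determined by $\operatorname{tr}(A\,\phi(T))=\operatorname{tr}(\phi^{\star}(A)\,T)$ for all $A,T\in\mathbb{M}_n$. Let $L:\mathbb{M}_n\to\mathbb{M}_n$ be a linear map. Then $(e^{tL})_{t\ge 0}$ is a semigroup of decomposable trace preserving maps that is $U$-covariant (i.e. every $e^{tL}$, $t\ge 0$, is decomposable, trace preserving and $U$-covariant) if and only if there exist a Hermitian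 matrix $H\in\mathbb{M}_n$ commuting with $U(g)$ for all $g\in\mathcal{G}$ and a $U$-covariant decomposable map $\varphi:\mathbb{M}_n\to\mathbb{M}_n$ such that, for all $A\in\mathbb{M}_n$, $$L(A)=-i[H,A]+\varphi(A)-\tfrac12\{\varphi^{\star}(I),A\}.$$ In particular, if $(e^{tL})_{t\ge 0}$ is a semigroup of decomposable trace preserving maps, then it is $U$-covariant if and only if such $H$ and $\varphi$ exist. -/

import Mathlib

open scoped Matrix ContDiff Manifold ComplexOrder

namespace DecQuantum

/-- The algebra `𝕄ₙ` of complex `n × n` matrices. -/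
abbrev Mat (n : ℕ) : Type := Matrix (Fin n) (Fin n) ℂ

/-- `φ` is `k`-positive: the map that applies `φ` to every entry of a `k × k` matrix over `𝕄ₙ`
is positive. An element of `𝕄ₖ(𝕄ₙ)` is positive iff the complex `kn × kn` matrix obtained by
erasing the inner brackets (`Matrix.comp`) is positive semidefinite. -/
def IsKPositive {n : ℕ} (k : ℕ) (φ : Mat n →ₗ[ℂ] Mat n) : Prop :=
  ∀ A : Matrix (Fin k) (Fin k) (Mat n),
    (Matrix.comp (Fin k) (Fin k) (Fin n) (Fin n) ℂ A).PosSemidef →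
      (Matrix.comp (Fin k) (Fin k) (Fin n) (Fin n) ℂ (A.map φ)).PosSemidef

/-- Completely positive maps. -/
def IsCP {n : ℕ} (φ : Mat n →ₗ[ℂ] Mat n) : Prop :=
  ∀ k : ℕ, IsKPositive k φ

/-- Matrix transposition as a linear map on `𝕄ₙ`. -/
def transposition (n : ℕ) : Mat n →ₗ[ℂ] Mat n :=
  (Matrix.transposeLinearEquiv (Fin n) (Fin n) ℂ ℂ).toLinearMap

/-- Completely copositive maps. -/
def IsCoCP {n : ℕ} (φ : Mat n →ₗ[ℂ] Mat n) : Prop :=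
  IsCP (transposition n ∘ₗ φ)

/-- Decomposable maps: sums of a completely positive and a completely copositive map. -/
def IsDecomposable {n : ℕ} (φ : Mat n →ₗ[ℂ] Mat n) : Prop :=
  ∃ φ₁ φ₂ : Mat n →ₗ[ℂ] Mat n, IsCP φ₁ ∧ IsCoCP φ₂ ∧ φ = φ₁ + φ₂

/-- Trace preserving maps. -/
def IsTracePreserving {n : ℕ} (φ : Mat n →ₗ[ℂ] Mat n) : Prop :=
  ∀ A : Mat n, (φ A).trace = A.trace

/-- The dual map with respect to the trace pairing `(A, T) ↦ tr (A T)`; see `trace_traceDual_mul`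
for the defining property, and `eq_traceDual` for uniqueness. -/
def traceDual {n : ℕ} (φ : Mat n →ₗ[ℂ] Mat n) : Mat n →ₗ[ℂ] Mat n where
  toFun A := Matrix.of fun i j => (A * φ (Matrix.single j i 1)).trace
  map_add' A B := by
    ext i j
    simp [add_mul]
  map_smul' c A := by
    ext i j
    simp

theorem trace_traceDual_mul {n : ℕ} (φ : Mat n →ₗ[ℂ] Mat n) (A T : Mat n) :
    (traceDual φ A * T).trace = (A * φ T).trace := by
  have hT : T = ∑ j, ∑ i, T j i • Matrix.single j i (1 : ℂ) := by
    conv_lhs => rw [Matrix.matrix_eq_sum_single T]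
    simp [Matrix.smul_single]
  conv_rhs => rw [hT]
  simp only [map_sum, map_smul, Matrix.mul_sum, Matrix.mul_smul, Matrix.trace_sum,
    Matrix.trace_smul, smul_eq_mul]
  rw [Finset.sum_comm]
  simp only [Matrix.trace, Matrix.diag, Matrix.mul_apply, traceDual, LinearMap.coe_mk,
    AddHom.coe_mk, Matrix.of_apply]
  exact Finset.sum_congr rfl fun i _ => Finset.sum_congr rfl fun j _ => mul_comm _ _

theorem eq_traceDual {n : ℕ} (φ ψ : Mat n →ₗ[ℂ] Mat n)
    (h : ∀ A T : Mat n, (ψ A * T).trace = (A * φ T).trace) : ψ = traceDual φ := by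
  ext1 A
  refine Matrix.ext_iff_trace_mul_right.mpr fun T => ?_
  rw [h, trace_traceDual_mul]

section

open scoped Matrix.Norms.L2Operator

/-- The semigroup `t ↦ e^{tL}`; the exponential series is taken in the Banach algebra `B(𝕄ₙ)` of
bounded linear maps on `𝕄ₙ`, the latter with its C⋆-norm. -/
noncomputable def expSemigroup {n : ℕ} (L : Mat n →ₗ[ℂ] Mat n) (t : ℝ) : Mat n →ₗ[ℂ] Mat n :=
  (NormedSpace.exp ((t : ℂ) • LinearMap.toContinuousLinearMap L) : Mat n →L[ℂ] Mat n).toLinearMap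

end

/-- `φ` is `U`-covariant: `φ ∘ Ad_{U(g)} = Ad_{U(g)} ∘ φ` for all `g`, where
`Ad_{V}(A) = V A Vᴴ`. -/
def IsCovariant {n : ℕ} {G : Type*} [Group G] (U : G →* Matrix.unitaryGroup (Fin n) ℂ)
    (φ : Mat n →ₗ[ℂ] Mat n) : Prop :=
  ∀ (g : G) (A : Mat n),
    φ ((U g : Mat n) * A * (U g : Mat n)ᴴ) = (U g : Mat n) * φ A * (U g : Mat n)ᴴ

/-- `L = -i[H, ·] + φ - ½ {φ⋆(I), ·}` -/
def HasGeneratorForm {n : ℕ} (L : Mat n →ₗ[ℂ] Mat n) (H : Mat n) (φ : Mat n →ₗ[ℂ] Mat n) :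
    Prop :=
  ∀ A : Mat n,
    L A = -Complex.I • (H * A - A * H) + φ A
      - (1 / 2 : ℂ) • (traceDual φ 1 * A + A * traceDual φ 1)

end DecQuantum

namespace DecQuantum

open Matrix Filter Topology

variable {n : ℕ}

/-! Necessity. `L` is a limit of maps `c (P + Q - id)` with `P` completely positive, `Q` completely
copositive and `c → ∞`. The terms `c P` may diverge, but the linear functional `defect` vanishes at
`id`, is nonnegative on completely positive maps and, for `n ≥ 2`, dominates the Choi trace of
completely copositive ones. So the `c Q` stay bounded and subconverge to a completely copositive
`φ`. The Choi form of `id` vanishes on traceless matrices, hence that of `L - φ` is nonnegative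
there (`exists_isCoCP_of_tendsto`).

This `φ` need not be covariant. The admissible `φ` form a closed convex set on which the `U g` act
isometrically, so its element of least norm is fixed, i.e. covariant (`exists_covariant_isCoCP`).
Compressing the Choi form of `L - φ` to traceless matrices then amounts to subtracting a drift `A ↦
D A + A Dᴴ`, which leaves a completely positive map (`isCP_sub_driftMatrix`). The matrix `D`
commutes with every `U g`; its skew part gives the Hamiltonian, and trace preservation turns its
Hermitian part into the anticommutator term.

Sufficiency. Up to an error that tends to `0`, `L` is a decomposable map minus a large multiple of
`id`. Decomposable maps form a closed cone stable under composition, so their exponentials are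
decomposable, and the multiple of `id` only contributes a positive factor
(`isDecomposable_expSemigroup_of_drift`). -/

/-! ### Complete positivity and Choi matrices. -/

theorem IsCP.add {φ ψ : Mat n →ₗ[ℂ] Mat n} (hφ : IsCP φ) (hψ : IsCP ψ) : IsCP (φ + ψ) := by
  intro k A hA
  exact (hφ k A hA).add (hψ k A hA)

theorem IsCP.smul {φ : Mat n →ₗ[ℂ] Mat n} (hφ : IsCP φ) {c : ℝ} (hc : 0 ≤ c) :
    IsCP ((c : ℂ) • φ) := by
  intro k A hA
  exact (hφ k A hA).smul (a := (c : ℂ)) (by exact_mod_cast hc)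

theorem IsCP.zero : IsCP (0 : Mat n →ₗ[ℂ] Mat n) := by
  intro k A hA
  exact PosSemidef.zero

theorem IsCP.id : IsCP (LinearMap.id : Mat n →ₗ[ℂ] Mat n) := by
  intro k A hA
  exact hA

theorem IsCP.comp {φ ψ : Mat n →ₗ[ℂ] Mat n} (hφ : IsCP φ) (hψ : IsCP ψ) : IsCP (φ ∘ₗ ψ) := by
  intro k A hA
  exact hφ k _ (hψ k A hA)

theorem IsCP.sum {ι : Type*} (s : Finset ι) {φ : ι → Mat n →ₗ[ℂ] Mat n}
    (h : ∀ i ∈ s, IsCP (φ i)) : IsCP (∑ i ∈ s, φ i) := by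
  classical
  induction s using Finset.induction_on with
  | empty => simpa using IsCP.zero
  | insert a s ha ih =>
    rw [Finset.sum_insert ha]
    exact (h a (by simp)).add (ih fun i hi => h i (by simp [hi]))

/-- Conjugation `A ↦ V A Vᴴ`. -/
def conj (V : Mat n) : Mat n →ₗ[ℂ] Mat n :=
  LinearMap.mulLeft ℂ V ∘ₗ LinearMap.mulRight ℂ Vᴴ

theorem conj_apply (V A : Mat n) : conj V A = V * A * Vᴴ := by
  simp [conj, mul_assoc]

theorem isCP_conj (V : Mat n) : IsCP (conj V) := by
  intro k A hA
  have h := hA.mul_mul_conjTranspose_same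
    (comp (Fin k) (Fin k) (Fin n) (Fin n) ℂ (diagonal fun _ => V))
  convert h using 1
  have h2 : A.map (conj V) = (diagonal fun _ => V) * A * (diagonal fun _ => Vᴴ) := by
    ext i j : 2
    simp [conj_apply]
  have h3 : (comp (Fin k) (Fin k) (Fin n) (Fin n) ℂ (diagonal fun _ => V))ᴴ
      = comp (Fin k) (Fin k) (Fin n) (Fin n) ℂ (diagonal fun _ => Vᴴ) := by
    ext p q
    by_cases hpq : p.1 = q.1
    · simp [comp_apply, hpq]
    · simp [comp_apply, hpq, Ne.symm hpq]
  rw [h2, h3]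
  have hm := fun X Y => map_mul (compRingEquiv (Fin k) (Fin n) ℂ) X Y
  simp only [compRingEquiv_apply] at hm
  rw [hm, hm]

/-- The correspondence between linear maps on `𝕄ₙ` and their Choi matrices. -/
def choi (n : ℕ) : (Mat n →ₗ[ℂ] Mat n) ≃ₗ[ℂ] Matrix (Fin n × Fin n) (Fin n × Fin n) ℂ where
  toFun φ := of fun p q => φ (single p.1 q.1 1) p.2 q.2
  map_add' _ _ := rfl
  map_smul' _ _ := rfl
  invFun C :=
    { toFun := fun A => of fun a b => ∑ i, ∑ j, A i j * C (i, a) (j, b)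
      map_add' := fun A B => by ext; simp [add_mul, Finset.sum_add_distrib]
      map_smul' := fun c A => by ext; simp [Finset.mul_sum, mul_assoc] }
  left_inv φ := by
    ext A a b
    have hA : A = ∑ i, ∑ j, A i j • single i j (1 : ℂ) := by
      conv_lhs => rw [matrix_eq_sum_single A]
      simp [smul_single]
    conv_rhs => rw [hA]
    simp only [map_sum, map_smul, Matrix.sum_apply, Matrix.smul_apply, smul_eq_mul]
    rfl
  right_inv C := by
    ext p q
    simp [single_apply, ite_and]

theorem choi_apply (φ : Mat n →ₗ[ℂ] Mat n) (p q : Fin n × Fin n) :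
    choi n φ p q = φ (single p.1 q.1 1) p.2 q.2 := rfl

theorem choi_symm_apply (C : Matrix (Fin n × Fin n) (Fin n × Fin n) ℂ) (A : Mat n)
    (a b : Fin n) : (choi n).symm C A a b = ∑ i, ∑ j, A i j * C (i, a) (j, b) := rfl

-- Choi's theorem. The Choi matrix is the image of the positive rank-one block matrix of matrix
-- units; conversely the rows of `B` in a factorization `Bᴴ B` of it give Kraus operators.
open scoped MatrixOrder in
theorem isCP_iff {φ : Mat n →ₗ[ℂ] Mat n} : IsCP φ ↔ (choi n φ).PosSemidef := by
  constructor
  · intro h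
    refine h n (of fun i j => single i j 1) ?_
    convert posSemidef_vecMulVec_self_star
      (fun p : Fin n × Fin n => if p.1 = p.2 then (1 : ℂ) else 0) using 1
    ext p q
    by_cases h1 : p.1 = p.2 <;> by_cases h2 : q.1 = q.2 <;>
      simp [comp_apply, vecMulVec_apply, h1, h2]
  · intro h
    obtain ⟨B, hB⟩ := CStarAlgebra.nonneg_iff_eq_star_mul_self.mp h.nonneg
    have hφ : φ = ∑ r, conj (of fun a i => star (B r (i, a))) := by
      rw [← (choi n).symm_apply_apply φ]
      ext A a b
      rw [choi_symm_apply, hB]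
      simp only [LinearMap.sum_apply, Matrix.sum_apply, conj_apply, mul_apply, Finset.sum_mul,
        Finset.mul_sum, star_eq_conjTranspose, conjTranspose_apply, of_apply, star_star]
      rw [Finset.sum_comm, Finset.sum_congr rfl fun j _ => Finset.sum_comm, Finset.sum_comm]
      refine Finset.sum_congr rfl fun r _ => Finset.sum_congr rfl fun j _ =>
        Finset.sum_congr rfl fun i _ => by ring
    rw [hφ]
    exact IsCP.sum _ fun r _ => isCP_conj _

theorem transposition_apply (A : Mat n) : transposition n A = Aᵀ := rfl

/-! ### Invariance of `∑ eᵢⱼ ⊗ eⱼᵢ` under unitaries. -/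

section Casimir

variable {W : Type*} [AddCommGroup W] [Module ℂ W] (F : Mat n →ₗ[ℂ] Mat n →ₗ[ℂ] W)

theorem mul_single_eq_sum (V : Mat n) (i j : Fin n) :
    V * single i j 1 = ∑ k, V k i • single k j (1 : ℂ) := by
  ext a b
  by_cases h : j = b <;> simp [mul_apply, Matrix.sum_apply, single_apply, h]

theorem single_mul_eq_sum (V : Mat n) (i j : Fin n) :
    single i j 1 * V = ∑ k, V j k • single i k (1 : ℂ) := by
  ext a b
  by_cases h : i = a <;> simp [mul_apply, Matrix.sum_apply, single_apply, h]

theorem sum_bilin_mul_left (V : Mat n) :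
    ∑ i, ∑ j, F (V * single i j 1) (single j i 1)
      = ∑ i, ∑ j, F (single i j 1) (single j i 1 * V) := by
  simp only [mul_single_eq_sum, single_mul_eq_sum, map_sum, map_smul, LinearMap.sum_apply,
    LinearMap.smul_apply]
  rw [Finset.sum_comm, Finset.sum_congr rfl fun j _ => Finset.sum_comm, Finset.sum_comm]

theorem sum_bilin_mul_right (V : Mat n) :
    ∑ i, ∑ j, F (single i j 1 * V) (single j i 1)
      = ∑ i, ∑ j, F (single i j 1) (V * single j i 1) := by
  simp only [mul_single_eq_sum, single_mul_eq_sum, map_sum, map_smul, LinearMap.sum_apply,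
    LinearMap.smul_apply]
  exact Finset.sum_congr rfl fun i _ => Finset.sum_comm

/-- A factor slides from one leg of `∑ eᵢⱼ ⊗ eⱼᵢ` to the other, where it meets its inverse. Every
later unitary invariance comes from here. -/
theorem sum_bilin_conj {V : Mat n} (hV : V * Vᴴ = 1) :
    ∑ i, ∑ j, F (conj V (single i j 1)) (conj V (single j i 1))
      = ∑ i, ∑ j, F (single i j 1) (single j i 1) := by
  have h1 := sum_bilin_mul_left (F.compl₁₂ (LinearMap.mulRight ℂ Vᴴ) (conj V)) V
  have h2 := sum_bilin_mul_right
    (F.compl₁₂ LinearMap.id (conj V ∘ₗ LinearMap.mulRight ℂ V)) Vᴴ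
  simp only [LinearMap.compl₁₂_apply, LinearMap.mulRight_apply, LinearMap.comp_apply,
    LinearMap.id_apply, conj_apply] at h1 h2 ⊢
  rw [h1, h2]
  refine Finset.sum_congr rfl fun i _ => Finset.sum_congr rfl fun j _ => ?_
  have h3 : V * (Vᴴ * single j i 1 * V) * Vᴴ = single j i (1 : ℂ) := by
    rw [← mul_assoc, ← mul_assoc, hV, one_mul, mul_assoc, hV, mul_one]
  rw [h3]

end Casimir

/-! ### The Choi form. -/

/-- The sesquilinear form of the Choi matrix of `φ`. -/
noncomputable def choiForm (φ : Mat n →ₗ[ℂ] Mat n) (X Y : Mat n) : ℂ :=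
  ∑ i, ∑ j, (Xᴴ * φ (single i j 1) * Y * single j i 1).trace

theorem choiForm_eq (φ : Mat n →ₗ[ℂ] Mat n) (X Y : Mat n) :
    choiForm φ X Y
      = star (fun p : Fin n × Fin n => X p.2 p.1) ⬝ᵥ choi n φ *ᵥ (fun p => Y p.2 p.1) := by
  simp only [choiForm, trace_mul_single, MulOpposite.op_one, one_smul, dotProduct, mulVec, Fintype.sum_prod_type, mul_apply,
    choi_apply, Finset.mul_sum, Finset.sum_mul, conjTranspose_apply, Pi.star_apply]
  refine Finset.sum_congr rfl fun i _ => ?_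
  rw [Finset.sum_congr rfl fun j _ => Finset.sum_comm, Finset.sum_comm]
  refine Finset.sum_congr rfl fun a _ => Finset.sum_congr rfl fun j _ =>
    Finset.sum_congr rfl fun b _ => ?_
  ring

theorem choiForm_add_map (φ ψ : Mat n →ₗ[ℂ] Mat n) (X Y : Mat n) :
    choiForm (φ + ψ) X Y = choiForm φ X Y + choiForm ψ X Y := by
  simp [choiForm, mul_add, add_mul, Finset.sum_add_distrib]

theorem choiForm_sub_map (φ ψ : Mat n →ₗ[ℂ] Mat n) (X Y : Mat n) :
    choiForm (φ - ψ) X Y = choiForm φ X Y - choiForm ψ X Y := by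
  simp [choiForm, mul_sub, sub_mul, Finset.sum_sub_distrib]

theorem choiForm_smul_map (c : ℂ) (φ : Mat n →ₗ[ℂ] Mat n) (X Y : Mat n) :
    choiForm (c • φ) X Y = c * choiForm φ X Y := by
  simp [choiForm, Finset.mul_sum]

theorem choiForm_sub_left (φ : Mat n →ₗ[ℂ] Mat n) (X X' Y : Mat n) :
    choiForm φ (X - X') Y = choiForm φ X Y - choiForm φ X' Y := by
  simp [choiForm, sub_mul, Finset.sum_sub_distrib]

theorem choiForm_sub_right (φ : Mat n →ₗ[ℂ] Mat n) (X Y Y' : Mat n) :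
    choiForm φ X (Y - Y') = choiForm φ X Y - choiForm φ X Y' := by
  simp [choiForm, mul_sub, sub_mul, Finset.sum_sub_distrib]

theorem choiForm_smul_left (φ : Mat n →ₗ[ℂ] Mat n) (c : ℂ) (X Y : Mat n) :
    choiForm φ (c • X) Y = star c * choiForm φ X Y := by
  simp [choiForm, Finset.mul_sum]

theorem choiForm_smul_right (φ : Mat n →ₗ[ℂ] Mat n) (c : ℂ) (X Y : Mat n) :
    choiForm φ X (c • Y) = c * choiForm φ X Y := by
  simp [choiForm, Finset.mul_sum]

theorem sum_trace_single (A B : Mat n) :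
    ∑ i, ∑ j, (A * single i j 1 * B * single j i 1).trace = A.trace * B.trace := by
  have h : ∀ i j, (A * single i j (1 : ℂ) * B : Mat n) i j = A i i * B j j := fun i j => by
    rw [mul_single_eq_sum, mul_apply]
    simp [Matrix.sum_apply, single_apply, ite_and]
  simp only [trace_mul_single, MulOpposite.op_one, one_smul, h]
  simp only [trace, diag, Finset.sum_mul_sum]

theorem choiForm_mulLeft (G X Y : Mat n) :
    choiForm (LinearMap.mulLeft ℂ G) X Y = (Xᴴ * G).trace * Y.trace := by
  simp only [choiForm, LinearMap.mulLeft_apply, ← mul_assoc, sum_trace_single]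

theorem choiForm_mulRight (G X Y : Mat n) :
    choiForm (LinearMap.mulRight ℂ G) X Y = star X.trace * (G * Y).trace := by
  rw [← trace_conjTranspose, ← sum_trace_single]
  simp only [choiForm, LinearMap.mulRight_apply, mul_assoc]

theorem choiForm_id (X Y : Mat n) :
    choiForm LinearMap.id X Y = star X.trace * Y.trace := by
  rw [← trace_conjTranspose, ← sum_trace_single]
  simp only [choiForm, LinearMap.id_apply]

theorem choiForm_conj {V : Mat n} (hV : V * Vᴴ = 1) (φ : Mat n →ₗ[ℂ] Mat n) (X Y : Mat n) :
    choiForm (conj Vᴴ ∘ₗ φ ∘ₗ conj V) X Y = choiForm φ (conj V X) (conj V Y) := by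
  have hV' : Vᴴ * V = 1 := mul_eq_one_comm.mp hV
  have h := sum_bilin_conj (LinearMap.mk₂ ℂ
    (fun A B : Mat n => ((conj V X)ᴴ * φ A * conj V Y * B).trace)
    (by simp [mul_add, add_mul]) (by simp) (by simp [mul_add]) (by simp)) hV
  simp only [LinearMap.mk₂_apply] at h
  rw [choiForm, choiForm, ← h]
  refine Finset.sum_congr rfl fun i _ => Finset.sum_congr rfl fun j _ => ?_
  simp only [LinearMap.comp_apply, conj_apply, conjTranspose_mul, conjTranspose_conjTranspose]
  have h1 : ∀ Z : Mat n, Vᴴ * (V * Z) = Z := fun Z => by rw [← mul_assoc, hV', one_mul]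
  conv_lhs => rw [← h1 (_ * single j i 1), ← trace_mul_comm]
  simp only [mul_assoc, h1]

/-- `φ` preserves adjoints. -/
def IsHermitianPreserving (φ : Mat n →ₗ[ℂ] Mat n) : Prop :=
  ∀ A : Mat n, φ Aᴴ = (φ A)ᴴ

theorem IsHermitianPreserving.eq {φ : Mat n →ₗ[ℂ] Mat n} (h : IsHermitianPreserving φ)
    (A : Mat n) : φ Aᴴ = (φ A)ᴴ := h A

theorem choi_isHermitian_iff {φ : Mat n →ₗ[ℂ] Mat n} :
    (choi n φ).IsHermitian ↔ IsHermitianPreserving φ := by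
  constructor
  · intro h A
    rw [← (choi n).symm_apply_apply φ]
    ext a b
    simp only [choi_symm_apply, conjTranspose_apply, star_sum, star_mul']
    rw [Finset.sum_comm]
    exact Finset.sum_congr rfl fun i _ => Finset.sum_congr rfl fun j _ => by rw [h.apply]
  · intro h
    ext p q
    have := congrFun (congrFun (h (single q.1 p.1 1)) p.2) q.2
    simpa [choi_apply] using this.symm

theorem isCP_iff_choiForm {φ : Mat n →ₗ[ℂ] Mat n} :
    IsCP φ ↔ IsHermitianPreserving φ ∧ ∀ X, 0 ≤ choiForm φ X X := by
  rw [isCP_iff, posSemidef_iff_dotProduct_mulVec, choi_isHermitian_iff]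
  refine and_congr_right fun _ => ⟨fun h X => ?_, fun h x => ?_⟩
  · rw [choiForm_eq]
    exact h _
  · simpa [choiForm_eq] using h (of fun a i => x (i, a))

theorem choiForm_star {φ : Mat n →ₗ[ℂ] Mat n} (h : IsHermitianPreserving φ) (X Y : Mat n) :
    star (choiForm φ X Y) = choiForm φ Y X := by
  simp only [choiForm, star_sum, ← trace_conjTranspose]
  rw [Finset.sum_comm]
  refine Finset.sum_congr rfl fun i _ => Finset.sum_congr rfl fun j _ => ?_
  rw [trace_mul_comm _ (single j i (1 : ℂ))]
  have h1 : (φ (single j i 1))ᴴ = φ (single i j 1) := by simp [← h.eq]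
  simp [mul_assoc, h1]

/-- The partial contraction `∑ φ(eᵢⱼ) eⱼᵢ`. -/
noncomputable def contraction (φ : Mat n →ₗ[ℂ] Mat n) : Mat n :=
  ∑ i, ∑ j, φ (single i j 1) * single j i 1

theorem choiForm_one_right (φ : Mat n →ₗ[ℂ] Mat n) (X : Mat n) :
    choiForm φ X 1 = (Xᴴ * contraction φ).trace := by
  simp [choiForm, contraction, Matrix.mul_sum, mul_assoc]

theorem contraction_conj {V : Mat n} (hV : V * Vᴴ = 1) {φ : Mat n →ₗ[ℂ] Mat n}
    (hφ : φ ∘ₗ conj V = conj V ∘ₗ φ) : conj V (contraction φ) = contraction φ := by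
  have hV' : Vᴴ * V = 1 := mul_eq_one_comm.mp hV
  have h := sum_bilin_conj (LinearMap.mk₂ ℂ (fun A B : Mat n => φ A * B)
    (by simp [add_mul]) (by simp) (by simp [mul_add]) (by simp)) hV
  simp only [LinearMap.mk₂_apply] at h
  conv_rhs => rw [contraction, ← h]
  simp only [contraction, map_sum]
  refine Finset.sum_congr rfl fun i _ => Finset.sum_congr rfl fun j _ => ?_
  have h1 : φ (conj V (single i j 1)) = conj V (φ (single i j 1)) := LinearMap.congr_fun hφ _
  have h2 : ∀ Z : Mat n, Vᴴ * (V * Z) = Z := fun Z => by rw [← mul_assoc, hV', one_mul]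
  rw [h1]
  simp only [conj_apply, mul_assoc, h2]

/-! ### The cone of decomposable maps. -/

theorem IsHermitianPreserving.add {φ ψ : Mat n →ₗ[ℂ] Mat n} (hφ : IsHermitianPreserving φ)
    (hψ : IsHermitianPreserving ψ) : IsHermitianPreserving (φ + ψ) := fun A => by
  simp [hφ.eq, hψ.eq]

theorem IsHermitianPreserving.sub {φ ψ : Mat n →ₗ[ℂ] Mat n} (hφ : IsHermitianPreserving φ)
    (hψ : IsHermitianPreserving ψ) : IsHermitianPreserving (φ - ψ) := fun A => by
  simp [hφ.eq, hψ.eq]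

theorem IsCP.isHermitianPreserving {φ : Mat n →ₗ[ℂ] Mat n} (h : IsCP φ) :
    IsHermitianPreserving φ := (isCP_iff_choiForm.mp h).1

theorem IsCoCP.isHermitianPreserving {φ : Mat n →ₗ[ℂ] Mat n} (h : IsCoCP φ) :
    IsHermitianPreserving φ := fun A =>
  transpose_injective (IsCP.isHermitianPreserving h A)

/-- The Choi matrix gets transposed. This lets a transposition cross a completely positive map, so
that decomposable maps are closed under composition. -/
theorem IsCP.comp_transposition {φ : Mat n →ₗ[ℂ] Mat n} (h : IsCP φ) :
    IsCP (transposition n ∘ₗ φ ∘ₗ transposition n) := by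
  rw [isCP_iff] at h ⊢
  have h1 : choi n (transposition n ∘ₗ φ ∘ₗ transposition n) = (choi n φ)ᵀ := by
    ext p q
    simp [choi_apply, transposition_apply]
  rw [h1]
  exact h.transpose

theorem IsCoCP.add {φ ψ : Mat n →ₗ[ℂ] Mat n} (hφ : IsCoCP φ) (hψ : IsCoCP ψ) :
    IsCoCP (φ + ψ) := by
  rw [IsCoCP, LinearMap.comp_add]
  exact IsCP.add hφ hψ

theorem IsCoCP.smul {φ : Mat n →ₗ[ℂ] Mat n} (hφ : IsCoCP φ) {c : ℝ} (hc : 0 ≤ c) :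
    IsCoCP ((c : ℂ) • φ) := by
  rw [IsCoCP, LinearMap.comp_smul]
  exact IsCP.smul hφ hc

theorem IsCoCP.zero : IsCoCP (0 : Mat n →ₗ[ℂ] Mat n) := by
  rw [IsCoCP, LinearMap.comp_zero]
  exact IsCP.zero

theorem IsCoCP.comp_isCP {φ ψ : Mat n →ₗ[ℂ] Mat n} (hφ : IsCoCP φ) (hψ : IsCP ψ) :
    IsCoCP (φ ∘ₗ ψ) := IsCP.comp (φ := transposition n ∘ₗ φ) hφ hψ

theorem IsCP.comp_isCoCP {φ ψ : Mat n →ₗ[ℂ] Mat n} (hφ : IsCP φ) (hψ : IsCoCP ψ) :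
    IsCoCP (φ ∘ₗ ψ) := by
  have h : transposition n ∘ₗ φ ∘ₗ ψ
      = (transposition n ∘ₗ φ ∘ₗ transposition n) ∘ₗ (transposition n ∘ₗ ψ) :=
    LinearMap.ext fun A => by simp [transposition_apply]
  rw [IsCoCP, h]
  exact hφ.comp_transposition.comp hψ

theorem IsCoCP.comp {φ ψ : Mat n →ₗ[ℂ] Mat n} (hφ : IsCoCP φ) (hψ : IsCoCP ψ) :
    IsCP (φ ∘ₗ ψ) := by
  have h : φ ∘ₗ ψ = (transposition n ∘ₗ (transposition n ∘ₗ φ) ∘ₗ transposition n)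
      ∘ₗ (transposition n ∘ₗ ψ) :=
    LinearMap.ext fun A => by simp [transposition_apply]
  rw [h]
  exact (IsCP.comp_transposition hφ).comp hψ

theorem IsCP.isDecomposable {φ : Mat n →ₗ[ℂ] Mat n} (h : IsCP φ) : IsDecomposable φ :=
  ⟨φ, 0, h, IsCoCP.zero, (add_zero φ).symm⟩

theorem IsDecomposable.isHermitianPreserving {φ : Mat n →ₗ[ℂ] Mat n} (h : IsDecomposable φ) :
    IsHermitianPreserving φ := by
  obtain ⟨P, Q, hP, hQ, rfl⟩ := h
  exact hP.isHermitianPreserving.add hQ.isHermitianPreserving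

theorem IsDecomposable.add {φ ψ : Mat n →ₗ[ℂ] Mat n} (hφ : IsDecomposable φ)
    (hψ : IsDecomposable ψ) : IsDecomposable (φ + ψ) := by
  obtain ⟨P, Q, hP, hQ, rfl⟩ := hφ
  obtain ⟨P', Q', hP', hQ', rfl⟩ := hψ
  exact ⟨P + P', Q + Q', hP.add hP', hQ.add hQ', by abel⟩

theorem IsDecomposable.smul {φ : Mat n →ₗ[ℂ] Mat n} (hφ : IsDecomposable φ) {c : ℝ}
    (hc : 0 ≤ c) : IsDecomposable ((c : ℂ) • φ) := by
  obtain ⟨P, Q, hP, hQ, rfl⟩ := hφ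
  exact ⟨(c : ℂ) • P, (c : ℂ) • Q, hP.smul hc, hQ.smul hc, smul_add _ _ _⟩

theorem IsDecomposable.comp {φ ψ : Mat n →ₗ[ℂ] Mat n} (hφ : IsDecomposable φ)
    (hψ : IsDecomposable ψ) : IsDecomposable (φ ∘ₗ ψ) := by
  obtain ⟨P, Q, hP, hQ, rfl⟩ := hφ
  obtain ⟨P', Q', hP', hQ', rfl⟩ := hψ
  refine ⟨P ∘ₗ P' + Q ∘ₗ Q', P ∘ₗ Q' + Q ∘ₗ P', (hP.comp hP').add (hQ.comp hQ'),
    (hP.comp_isCoCP hQ').add (hQ.comp_isCP hP'), ?_⟩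
  rw [LinearMap.add_comp, LinearMap.comp_add, LinearMap.comp_add]
  abel

theorem IsDecomposable.pow {φ : Mat n →ₗ[ℂ] Mat n} (hφ : IsDecomposable φ) (k : ℕ) :
    IsDecomposable (φ ^ k) := by
  induction k with
  | zero => exact IsCP.id.isDecomposable
  | succ k ih => exact ih.comp hφ

theorem IsDecomposable.sum {ι : Type*} (s : Finset ι) {φ : ι → Mat n →ₗ[ℂ] Mat n}
    (h : ∀ i ∈ s, IsDecomposable (φ i)) : IsDecomposable (∑ i ∈ s, φ i) := by
  classical
  induction s using Finset.induction_on with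
  | empty => simpa using IsCP.zero.isDecomposable
  | insert a s ha ih =>
    rw [Finset.sum_insert ha]
    exact (h a (by simp)).add (ih fun i hi => h i (by simp [hi]))

/-! ### Covariance. -/

section Unitary

variable {G : Type*} [Group G] {U : G →* unitaryGroup (Fin n) ℂ}

theorem unitary_mul_conjTranspose (V : unitaryGroup (Fin n) ℂ) : (V : Mat n) * (V : Mat n)ᴴ = 1 :=
  mem_unitaryGroup_iff.mp V.2

theorem unitary_conjTranspose_mul (V : unitaryGroup (Fin n) ℂ) : (V : Mat n)ᴴ * (V : Mat n) = 1 :=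
  mem_unitaryGroup_iff'.mp V.2

theorem isCovariant_iff {φ : Mat n →ₗ[ℂ] Mat n} :
    IsCovariant U φ ↔ ∀ g, φ ∘ₗ conj (U g : Mat n) = conj (U g : Mat n) ∘ₗ φ := by
  refine forall_congr' fun g => ⟨fun h => ?_, fun h A => ?_⟩
  · ext1 A
    simpa [conj_apply] using h A
  · simpa [conj_apply] using LinearMap.congr_fun h A

theorem IsCovariant.add {φ ψ : Mat n →ₗ[ℂ] Mat n} (hφ : IsCovariant U φ)
    (hψ : IsCovariant U ψ) : IsCovariant U (φ + ψ) := fun g A => by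
  simp [hφ g A, hψ g A, mul_add, add_mul]

theorem IsCovariant.sub {φ ψ : Mat n →ₗ[ℂ] Mat n} (hφ : IsCovariant U φ)
    (hψ : IsCovariant U ψ) : IsCovariant U (φ - ψ) := fun g A => by
  simp [hφ g A, hψ g A, mul_sub, sub_mul]

theorem conj_eq_iff_commute (V : unitaryGroup (Fin n) ℂ) (A : Mat n) :
    conj (V : Mat n) A = A ↔ (V : Mat n) * A = A * (V : Mat n) := by
  rw [conj_apply]
  constructor
  · intro h
    conv_rhs => rw [← h, mul_assoc, unitary_conjTranspose_mul, mul_one]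
  · intro h
    rw [h, mul_assoc, unitary_mul_conjTranspose, mul_one]

theorem commute_conjTranspose {V : unitaryGroup (Fin n) ℂ} {A : Mat n}
    (h : (V : Mat n) * A = A * (V : Mat n)) : (V : Mat n) * Aᴴ = Aᴴ * (V : Mat n) := by
  rw [← conj_eq_iff_commute, conj_apply] at h ⊢
  conv_rhs => rw [← h]
  simp [mul_assoc]

theorem isCovariant_mulLeft_add_mulRight {A B : Mat n}
    (hA : ∀ g, (U g : Mat n) * A = A * (U g : Mat n))
    (hB : ∀ g, (U g : Mat n) * B = B * (U g : Mat n)) :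
    IsCovariant U (LinearMap.mulLeft ℂ A + LinearMap.mulRight ℂ B) := fun g X => by
  have h : (U g : Mat n)ᴴ * B = B * (U g : Mat n)ᴴ := by
    have := congrArg conjTranspose (commute_conjTranspose (hB g))
    simpa using this.symm
  simp only [LinearMap.add_apply, LinearMap.mulLeft_apply, LinearMap.mulRight_apply, mul_add,
    add_mul]
  rw [← mul_assoc, ← mul_assoc, ← hA g, mul_assoc _ _ B, h]
  simp only [mul_assoc]

end Unitary

/-! ### Splitting off the drift. -/

/-- The multiplier splitting off the part of `ψ` that is not completely positive. -/
noncomputable def driftMatrix (ψ : Mat n →ₗ[ℂ] Mat n) : Mat n :=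
  (1 / n : ℂ) • contraction ψ - ((contraction ψ).trace / (2 * n ^ 2)) • 1

/-- A conditionally completely positive map is completely positive up to left and right
multiplications. -/
theorem isCP_sub_driftMatrix [NeZero n] {ψ : Mat n →ₗ[ℂ] Mat n} (hψ : IsHermitianPreserving ψ)
    (hpos : ∀ X : Mat n, X.trace = 0 → 0 ≤ choiForm ψ X X) :
    IsCP (ψ - (LinearMap.mulLeft ℂ (driftMatrix ψ) + LinearMap.mulRight ℂ (driftMatrix ψ)ᴴ)) := by
  have hn : (n : ℂ) ≠ 0 := by exact_mod_cast NeZero.ne n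
  rw [isCP_iff_choiForm]
  constructor
  · refine hψ.sub fun A => ?_
    simp [add_comm]
  · intro X
    set K := contraction ψ with hK
    have hKtr : star K.trace = K.trace := by
      have h1 : choiForm ψ 1 1 = K.trace := by simp [choiForm_one_right, hK]
      rw [← h1, choiForm_star hψ]
    -- The corrected form at `X` is the form of `ψ` at the traceless part of `X`. The `|tr X|²` term
    -- is shared equally by the two multiplications, hence the `2 * n ^ 2` in `driftMatrix`.
    have hX := hpos (X - (X.trace / n) • 1) (by simp [hn])
    convert hX using 1
    have hXK : choiForm ψ 1 X = star (Xᴴ * K).trace := by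
      rw [← choiForm_star hψ, choiForm_one_right]
    have hG : ((driftMatrix ψ)ᴴ * X).trace = star (Xᴴ * driftMatrix ψ).trace := by
      rw [← trace_conjTranspose]
      simp
    have hG2 : (Xᴴ * driftMatrix ψ).trace
        = (Xᴴ * K).trace / n - K.trace / (2 * n ^ 2) * star X.trace := by
      rw [← trace_conjTranspose]
      simp [driftMatrix, mul_sub, ← hK]
      ring
    rw [choiForm_sub_map, choiForm_add_map, choiForm_mulLeft, choiForm_mulRight, hG, hG2]
    simp only [choiForm_sub_left, choiForm_sub_right, choiForm_smul_left, choiForm_smul_right,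
      choiForm_one_right, hXK, star_sub, star_div₀, star_mul', star_star, hKtr]
    simp only [← hK]
    simp [sub_mul]
    field_simp
    ring

theorem driftMatrix_commute {V : unitaryGroup (Fin n) ℂ} {ψ : Mat n →ₗ[ℂ] Mat n}
    (h : ψ ∘ₗ conj (V : Mat n) = conj (V : Mat n) ∘ₗ ψ) :
    (V : Mat n) * driftMatrix ψ = driftMatrix ψ * (V : Mat n) := by
  have h1 := (conj_eq_iff_commute V _).mp (contraction_conj (unitary_mul_conjTranspose V) h)
  simp [driftMatrix, mul_sub, sub_mul, h1]

theorem eq_zero_of_trace_mul {A : Mat n} (h : ∀ X : Mat n, (A * X).trace = 0) : A = 0 :=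
  ext_iff_trace_mul_right.mpr fun X => by simp [h]

theorem exists_generatorForm_of_isCoCP [NeZero n] {G : Type*} [Group G]
    {U : G →* unitaryGroup (Fin n) ℂ} {L φ : Mat n →ₗ[ℂ] Mat n}
    (hL : IsHermitianPreserving L) (hLU : IsCovariant U L) (hLtr : ∀ A, (L A).trace = 0)
    (hφ : IsCoCP φ) (hφU : IsCovariant U φ)
    (hpos : ∀ X : Mat n, X.trace = 0 → 0 ≤ choiForm (L - φ) X X) :
    ∃ (H : Mat n) (φ : Mat n →ₗ[ℂ] Mat n),
      H.IsHermitian ∧ H ∈ Set.centralizer (Set.range fun g : G => (U g : Mat n)) ∧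
      IsDecomposable φ ∧ IsCovariant U φ ∧ HasGeneratorForm L H φ := by
  set D := driftMatrix (L - φ) with hD
  have hDU : ∀ g, (U g : Mat n) * D = D * (U g : Mat n) := fun g =>
    driftMatrix_commute (isCovariant_iff.mp (hLU.sub hφU) g)
  have hDU' : ∀ g, (U g : Mat n) * Dᴴ = Dᴴ * (U g : Mat n) := fun g =>
    commute_conjTranspose (hDU g)
  have hCP := isCP_sub_driftMatrix (hL.sub hφ.isHermitianPreserving) hpos
  set χ := L - (LinearMap.mulLeft ℂ D + LinearMap.mulRight ℂ Dᴴ) with hχ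
  -- `L` annihilates the trace, so the trace of `χ X` is minus that of the drift.
  have hdual : traceDual χ 1 = -(D + Dᴴ) := by
    rw [← add_eq_zero_iff_eq_neg]
    refine eq_zero_of_trace_mul fun X => ?_
    have h1 := trace_traceDual_mul χ 1 X
    rw [add_mul, trace_add, h1]
    simp only [hχ, LinearMap.sub_apply, LinearMap.add_apply, LinearMap.mulLeft_apply,
      LinearMap.mulRight_apply, one_mul, trace_sub, trace_add, hLtr, add_mul]
    rw [trace_mul_comm X]
    ring
  -- Chosen so that `-i H` is the skew part of `D`. The map `χ` is the completely positive map of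
  -- `hCP` plus `φ`.
  refine ⟨(Complex.I / 2) • (D - Dᴴ), χ, ?_, ?_, ⟨_, _, hCP, hφ, ?_⟩,
    hLU.sub (isCovariant_mulLeft_add_mulRight hDU hDU'), fun A => ?_⟩
  · rw [IsHermitian, conjTranspose_smul]
    simp only [conjTranspose_sub, conjTranspose_conjTranspose]
    rw [← neg_sub D, smul_neg, ← neg_smul]
    simp [neg_div]
  · rintro _ ⟨g, rfl⟩
    simp only [mul_smul_comm, smul_mul_assoc, mul_sub, sub_mul, hDU, hDU']
  · rw [hχ]
    abel
  · have hI : ∀ X : Mat n, -Complex.I • (Complex.I / 2) • X = (1 / 2 : ℂ) • X := fun X => by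
      rw [smul_smul]
      congr 1
      linear_combination (-1 / 2 : ℂ) * Complex.I_mul_I
    rw [hdual, smul_mul_assoc, mul_smul_comm, ← smul_sub, hI, hχ]
    simp only [LinearMap.sub_apply, LinearMap.add_apply, LinearMap.mulLeft_apply,
      LinearMap.mulRight_apply, sub_mul, mul_sub, neg_mul, mul_neg, add_mul, mul_add]
    module

/-! ### Compactness of positive matrices of bounded trace. -/

section PosSemidef

theorem re_diag_nonneg_of_posSemidef {ι : Type*} {C : Matrix ι ι ℂ} (hC : C.PosSemidef) (p : ι) :
    0 ≤ (C p p).re := (Complex.le_def.mp hC.diag_nonneg).1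

variable {ι : Type*} [Fintype ι]

open scoped MatrixOrder in
theorem norm_apply_le_of_posSemidef [DecidableEq ι] {C : Matrix ι ι ℂ} (hC : C.PosSemidef)
    (p q : ι) : ‖C p q‖ ≤ ((C p p).re + (C q q).re) / 2 := by
  obtain ⟨B, rfl⟩ := CStarAlgebra.nonneg_iff_eq_star_mul_self.mp hC.nonneg
  have hd : ∀ p, ((star B * B) p p).re = ∑ r, ‖B r p‖ ^ 2 := fun p => by
    simp only [star_eq_conjTranspose, mul_apply, conjTranspose_apply, Complex.re_sum]
    refine Finset.sum_congr rfl fun r _ => ?_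
    rw [Complex.star_def, ← Complex.normSq_eq_conj_mul_self, Complex.ofReal_re,
      Complex.normSq_eq_norm_sq]
  rw [hd, hd, ← Finset.sum_add_distrib, Finset.sum_div, star_eq_conjTranspose, mul_apply]
  refine (norm_sum_le _ _).trans (Finset.sum_le_sum fun r _ => ?_)
  rw [norm_mul, conjTranspose_apply, norm_star]
  linarith [sq_nonneg (‖B r p‖ - ‖B r q‖)]

theorem re_apply_le_of_posSemidef [DecidableEq ι] {C : Matrix ι ι ℂ} (hC : C.PosSemidef)
    (p q : ι) : (C p q).re ≤ ((C p p).re + (C q q).re) / 2 :=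
  (Complex.re_le_norm _).trans (norm_apply_le_of_posSemidef hC p q)

theorem re_diag_le_trace_of_posSemidef {C : Matrix ι ι ℂ} (hC : C.PosSemidef) (p : ι) :
    (C p p).re ≤ C.trace.re := by
  rw [trace, Complex.re_sum]
  exact Finset.single_le_sum (f := fun p => (C p p).re)
    (fun p _ => re_diag_nonneg_of_posSemidef hC p) (Finset.mem_univ p)

theorem isClosed_posSemidef : IsClosed {C : Matrix ι ι ℂ | C.PosSemidef} := by
  simp only [posSemidef_iff_dotProduct_mulVec, Set.ofPred_and, Set.ofPred_forall]
  refine (isClosed_eq (by fun_prop) (by fun_prop)).inter (isClosed_iInter fun x => ?_)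
  exact isClosed_le continuous_const (by fun_prop)

theorem isCompact_posSemidef_trace_le (κ : ℝ) :
    IsCompact {C : Matrix ι ι ℂ | C.PosSemidef ∧ C.trace.re ≤ κ} := by
  classical
  have hK : IsCompact (Set.univ.pi fun _ : ι => Set.univ.pi fun _ : ι =>
      Metric.closedBall (0 : ℂ) κ) :=
    isCompact_univ_pi fun _ => isCompact_univ_pi fun _ => isCompact_closedBall _ _
  refine hK.of_isClosed_subset (isClosed_posSemidef.inter
    (isClosed_le (Complex.continuous_re.comp (continuous_id.matrix_trace))
      continuous_const)) fun C hC p _ q _ => ?_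
  rw [mem_closedBall_zero_iff]
  have h1 := norm_apply_le_of_posSemidef hC.1 p q
  have h2 := re_diag_le_trace_of_posSemidef hC.1 p
  have h3 := re_diag_le_trace_of_posSemidef hC.1 q
  linarith [hC.2]

end PosSemidef

/-! ### Limits of positive and decomposable maps. -/

section Limits

variable {φ : ℕ → Mat n →ₗ[ℂ] Mat n} {ψ : Mat n →ₗ[ℂ] Mat n}

theorem tendsto_choi (h : ∀ A, Tendsto (fun m => φ m A) atTop (𝓝 (ψ A))) :
    Tendsto (fun m => choi n (φ m)) atTop (𝓝 (choi n ψ)) := by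
  refine tendsto_pi_nhds.mpr fun p => tendsto_pi_nhds.mpr fun q => ?_
  exact tendsto_pi_nhds.mp (tendsto_pi_nhds.mp (h (single p.1 q.1 1)) p.2) q.2

theorem isCP_of_tendsto (hφ : ∀ m, IsCP (φ m))
    (h : ∀ A, Tendsto (fun m => φ m A) atTop (𝓝 (ψ A))) : IsCP ψ :=
  isCP_iff.mpr (isClosed_posSemidef.mem_of_tendsto (tendsto_choi h)
    (Eventually.of_forall fun m => isCP_iff.mp (hφ m)))

theorem isCoCP_of_tendsto (hφ : ∀ m, IsCoCP (φ m))
    (h : ∀ A, Tendsto (fun m => φ m A) atTop (𝓝 (ψ A))) : IsCoCP ψ := by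
  refine isCP_of_tendsto (φ := fun m => transposition n ∘ₗ φ m) hφ fun A => ?_
  exact ((continuous_id.matrix_transpose).tendsto _).comp (h A)

theorem tendsto_choiForm (h : ∀ A, Tendsto (fun m => φ m A) atTop (𝓝 (ψ A))) (X Y : Mat n) :
    Tendsto (fun m => choiForm (φ m) X Y) atTop (𝓝 (choiForm ψ X Y)) := by
  have hc : ∀ i j, Continuous fun M : Mat n => (Xᴴ * M * Y * single j i 1).trace := fun i j =>
    (((continuous_const.matrix_mul continuous_id).matrix_mul continuous_const).matrix_mul
      continuous_const).matrix_trace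
  unfold choiForm
  exact tendsto_finsetSum _ fun i _ => tendsto_finsetSum _ fun j _ =>
    ((hc i j).tendsto (ψ (single i j 1))).comp (h (single i j 1))

theorem exists_subseq_tendsto_of_isCP (hφ : ∀ m, IsCP (φ m)) {κ : ℝ}
    (hκ : ∀ m, (choi n (φ m)).trace.re ≤ κ) : ∃ (ψ : Mat n →ₗ[ℂ] Mat n) (s : ℕ → ℕ),
      StrictMono s ∧ ∀ A, Tendsto (fun k => φ (s k) A) atTop (𝓝 (ψ A)) := by
  have : FirstCountableTopology (Matrix (Fin n × Fin n) (Fin n × Fin n) ℂ) :=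
    inferInstanceAs (FirstCountableTopology (Fin n × Fin n → Fin n × Fin n → ℂ))
  obtain ⟨C, -, s, hs, hC⟩ := (isCompact_posSemidef_trace_le κ).tendsto_subseq
    (x := fun m => choi n (φ m)) fun m => ⟨isCP_iff.mp (hφ m), hκ m⟩
  refine ⟨(choi n).symm C, s, hs, fun A => ?_⟩
  refine tendsto_pi_nhds.mpr fun a => tendsto_pi_nhds.mpr fun b => ?_
  have h1 : ∀ k, φ (s k) A a b = ∑ i, ∑ j, A i j * choi n (φ (s k)) (i, a) (j, b) := fun k => by
    rw [← choi_symm_apply, LinearEquiv.symm_apply_apply]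
  simp only [h1, choi_symm_apply]
  refine tendsto_finsetSum _ fun i _ => tendsto_finsetSum _ fun j _ => ?_
  exact (tendsto_pi_nhds.mp (tendsto_pi_nhds.mp hC _) _).const_mul _

theorem trace_choi_transposition (φ : Mat n →ₗ[ℂ] Mat n) :
    (choi n (transposition n ∘ₗ φ)).trace = (choi n φ).trace := by
  simp [trace, choi_apply, transposition_apply]

theorem IsCP.trace_choi_nonneg {φ : Mat n →ₗ[ℂ] Mat n} (h : IsCP φ) :
    0 ≤ (choi n φ).trace.re := (Complex.le_def.mp (isCP_iff.mp h).trace_nonneg).1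

theorem IsCoCP.trace_choi_nonneg {φ : Mat n →ₗ[ℂ] Mat n} (h : IsCoCP φ) :
    0 ≤ (choi n φ).trace.re := by
  rw [← trace_choi_transposition]
  exact IsCP.trace_choi_nonneg h

/-- Both summands have nonnegative Choi trace and the total converges, so the completely positive
summands are bounded and subconverge; the others then converge too. -/
theorem isDecomposable_of_tendsto (hφ : ∀ m, IsDecomposable (φ m))
    (h : ∀ A, Tendsto (fun m => φ m A) atTop (𝓝 (ψ A))) : IsDecomposable ψ := by
  choose P Q hP hQ hPQ using hφ
  have ht : Tendsto (fun m => (choi n (φ m)).trace.re) atTop (𝓝 (choi n ψ).trace.re) :=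
    ((Complex.continuous_re.comp continuous_id.matrix_trace).tendsto _).comp (tendsto_choi h)
  obtain ⟨κ, hκ⟩ := ht.bddAbove_range
  obtain ⟨P', s, hs, hP'⟩ := exists_subseq_tendsto_of_isCP hP (κ := κ) fun m => by
    have h1 := hκ ⟨m, rfl⟩
    have h2 := (hQ m).trace_choi_nonneg
    simp only [hPQ m, map_add, trace_add, Complex.add_re] at h1
    linarith
  refine ⟨P', ψ - P', isCP_of_tendsto (fun k => hP (s k)) hP',
    isCoCP_of_tendsto (fun k => hQ (s k)) fun A => ?_, by abel⟩
  have h1 := ((h A).comp hs.tendsto_atTop).sub (hP' A)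
  refine h1.congr fun k => ?_
  simp [hPQ]

end Limits

/-! ### The defect functional. -/

section Defect

theorem choiForm_one_one (φ : Mat n →ₗ[ℂ] Mat n) :
    choiForm φ 1 1 = ∑ i, ∑ j, φ (single i j 1) i j := by
  simp [choiForm, trace_mul_single]

/-- A functional that vanishes at the identity and is nonnegative on decomposable maps. -/
noncomputable def defect (φ : Mat n →ₗ[ℂ] Mat n) : ℝ :=
  n * (choi n φ).trace.re - (choiForm φ 1 1).re

theorem defect_id : defect (LinearMap.id : Mat n →ₗ[ℂ] Mat n) = 0 := by
  rw [defect, choiForm_id, trace, Fintype.sum_prod_type]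
  simp [choi_apply, single_apply]

theorem defect_add (φ ψ : Mat n →ₗ[ℂ] Mat n) : defect (φ + ψ) = defect φ + defect ψ := by
  simp only [defect, map_add, trace_add, Complex.add_re, choiForm_add_map]
  ring

theorem defect_smul (c : ℝ) (φ : Mat n →ₗ[ℂ] Mat n) :
    defect ((c : ℂ) • φ) = c * defect φ := by
  simp only [defect, map_smul, trace_smul, smul_eq_mul, Complex.re_ofReal_mul, choiForm_smul_map]
  ring

theorem tendsto_defect {φ : ℕ → Mat n →ₗ[ℂ] Mat n} {ψ : Mat n →ₗ[ℂ] Mat n}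
    (h : ∀ A, Tendsto (fun m => φ m A) atTop (𝓝 (ψ A))) :
    Tendsto (fun m => defect (φ m)) atTop (𝓝 (defect ψ)) := by
  have h1 : Tendsto (fun m => (choi n (φ m)).trace.re) atTop (𝓝 (choi n ψ).trace.re) :=
    ((Complex.continuous_re.comp continuous_id.matrix_trace).tendsto _).comp (tendsto_choi h)
  exact (h1.const_mul _).sub ((Complex.continuous_re.tendsto _).comp (tendsto_choiForm h 1 1))

/-- `choiForm φ 1 1` sums the Choi entries at `((i, i), (j, j))`; each is at most the mean of two
diagonal entries, so the sum is at most `n` times the trace. -/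
theorem IsCP.defect_nonneg {φ : Mat n →ₗ[ℂ] Mat n} (h : IsCP φ) : 0 ≤ defect φ := by
  have hC := isCP_iff.mp h
  have h1 : (choiForm φ 1 1).re
      ≤ ∑ i, ∑ j, ((choi n φ (i, i) (i, i)).re + (choi n φ (j, j) (j, j)).re) / 2 := by
    simp only [choiForm_one_one, Complex.re_sum]
    exact Finset.sum_le_sum fun i _ => Finset.sum_le_sum fun j _ =>
      re_apply_le_of_posSemidef hC (i, i) (j, j)
  have h2 : ∑ i : Fin n, (choi n φ (i, i) (i, i)).re ≤ (choi n φ).trace.re := by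
    rw [trace, Complex.re_sum, Fintype.sum_prod_type]
    exact Finset.sum_le_sum fun i _ => Finset.single_le_sum
      (f := fun j => (choi n φ (i, j) (i, j)).re)
      (fun j _ => re_diag_nonneg_of_posSemidef hC (i, j)) (Finset.mem_univ i)
  have h3 : ∑ i, ∑ j, ((choi n φ (i, i) (i, i)).re + (choi n φ (j, j) (j, j)).re) / 2
      = n * ∑ i : Fin n, (choi n φ (i, i) (i, i)).re := by
    simp only [← Finset.sum_div, Finset.sum_add_distrib, Finset.sum_const, Finset.card_univ,
      Fintype.card_fin, nsmul_eq_mul, ← Finset.mul_sum]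
    ring
  have h4 := mul_le_mul_of_nonneg_left h2 n.cast_nonneg
  rw [defect]
  linarith

/-- After transposition the same entries sit at `((i, j), (j, i))`, and each diagonal entry is used
only once on average. So `choiForm φ 1 1` is at most the trace rather than `n` times it, and the
surplus `n - 1 ≥ 1` controls the trace. -/
theorem IsCoCP.trace_choi_le_defect {φ : Mat n →ₗ[ℂ] Mat n} (h : IsCoCP φ) (hn : 2 ≤ n) :
    (choi n (transposition n ∘ₗ φ)).trace.re ≤ defect φ := by
  have hC := isCP_iff.mp h
  set C := choi n (transposition n ∘ₗ φ) with hCdef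
  have h1 : (choiForm φ 1 1).re
      ≤ ∑ i, ∑ j, ((C (i, j) (i, j)).re + (C (j, i) (j, i)).re) / 2 := by
    simp only [choiForm_one_one, Complex.re_sum]
    exact Finset.sum_le_sum fun i _ => Finset.sum_le_sum fun j _ =>
      re_apply_le_of_posSemidef hC (i, j) (j, i)
  have h2 : ∑ i, ∑ j, ((C (i, j) (i, j)).re + (C (j, i) (j, i)).re) / 2 = C.trace.re := by
    rw [trace, Complex.re_sum, Fintype.sum_prod_type]
    simp only [← Finset.sum_div, Finset.sum_add_distrib, diag_apply]
    rw [Finset.sum_comm (f := fun i j => (C (j, i) (j, i)).re)]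
    ring
  have h3 : 0 ≤ C.trace.re := h.trace_choi_nonneg.trans_eq (by rw [hCdef, trace_choi_transposition])
  have h4 : (2 : ℝ) ≤ n := by exact_mod_cast hn
  rw [defect, ← trace_choi_transposition φ, ← hCdef]
  nlinarith

end Defect

/-! ### Making the copositive part covariant by minimal norm. -/

/-- A closed nonempty midpoint-convex set has a unique element of minimal norm. -/
theorem exists_unique_minimal_norm {E : Type*} [NormedAddCommGroup E] [InnerProductSpace ℂ E]
    [ProperSpace E] {S : Set E} (hS : IsClosed S) (hne : S.Nonempty)
    (hmid : ∀ x ∈ S, ∀ y ∈ S, (1 / 2 : ℂ) • (x + y) ∈ S) :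
    ∃ x ∈ S, ∀ y ∈ S, ‖y‖ ≤ ‖x‖ → y = x := by
  obtain ⟨x, hx, hmin⟩ := hS.exists_infDist_eq_dist hne 0
  have hle : ∀ y ∈ S, ‖x‖ ≤ ‖y‖ := fun y hy => by
    have := Metric.infDist_le_dist_of_mem (x := 0) hy
    rwa [hmin, dist_zero_left, dist_zero_left] at this
  refine ⟨x, hx, fun y hy hyx => ?_⟩
  have h1 := parallelogram_law_with_norm ℂ x y
  have h2 := hle _ (hmid x hx y hy)
  rw [norm_smul] at h2
  have h3 : ‖(1 / 2 : ℂ)‖ = 1 / 2 := by simp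
  rw [h3] at h2
  have h4 : ‖x - y‖ * ‖x - y‖ ≤ 0 := by nlinarith [norm_nonneg x, norm_nonneg y]
  have h5 : ‖x - y‖ = 0 := mul_self_eq_zero.mp (le_antisymm h4 (mul_self_nonneg _))
  exact (sub_eq_zero.mp (norm_eq_zero.mp h5)).symm

/-- The Hilbert space of Choi matrices. -/
abbrev ChoiSpace (n : ℕ) : Type := EuclideanSpace ℂ ((Fin n × Fin n) × (Fin n × Fin n))

/-- The linear map with a given Choi matrix. -/
noncomputable def ofChoiSpace (x : ChoiSpace n) : Mat n →ₗ[ℂ] Mat n :=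
  (choi n).symm (of fun p q => x (p, q))

/-- The Choi matrix of a linear map, as a vector. -/
noncomputable def toChoiSpace (φ : Mat n →ₗ[ℂ] Mat n) : ChoiSpace n :=
  WithLp.toLp 2 fun r => choi n φ r.1 r.2

theorem ofChoiSpace_toChoiSpace (φ : Mat n →ₗ[ℂ] Mat n) : ofChoiSpace (toChoiSpace φ) = φ :=
  (choi n).symm_apply_apply φ

theorem toChoiSpace_ofChoiSpace (x : ChoiSpace n) : toChoiSpace (ofChoiSpace x) = x := by
  ext r
  simp [toChoiSpace, ofChoiSpace]

theorem ofChoiSpace_add (x y : ChoiSpace n) :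
    ofChoiSpace (x + y) = ofChoiSpace x + ofChoiSpace y := by
  rw [ofChoiSpace, ofChoiSpace, ofChoiSpace, ← map_add]
  rfl

theorem ofChoiSpace_smul (c : ℂ) (x : ChoiSpace n) :
    ofChoiSpace (c • x) = c • ofChoiSpace x := by
  rw [ofChoiSpace, ofChoiSpace, ← map_smul]
  rfl

theorem continuous_ofChoiSpace_apply (A : Mat n) :
    Continuous fun x : ChoiSpace n => ofChoiSpace x A := by
  refine continuous_matrix fun a b => ?_
  simp only [ofChoiSpace, choi_symm_apply, of_apply]
  fun_prop

theorem norm_sq_toChoiSpace (φ : Mat n →ₗ[ℂ] Mat n) :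
    ((‖toChoiSpace φ‖ ^ 2 : ℝ) : ℂ)
      = ∑ i, ∑ j, ((φ (single i j 1))ᴴ * φ (single i j 1)).trace := by
  rw [EuclideanSpace.norm_sq_eq]
  simp only [toChoiSpace, Fintype.sum_prod_type, choi_apply, trace, diag_apply, mul_apply,
    conjTranspose_apply, Complex.ofReal_sum]
  refine Finset.sum_congr rfl fun i _ => ?_
  rw [Finset.sum_comm]
  refine Finset.sum_congr rfl fun j _ => ?_
  rw [Finset.sum_comm]
  refine Finset.sum_congr rfl fun b _ => Finset.sum_congr rfl fun a _ => ?_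
  rw [Complex.star_def, ← Complex.normSq_eq_conj_mul_self, Complex.normSq_eq_norm_sq]

/-- The squared norm is `∑ tr (φ(eᵢⱼ)ᴴ φ(eᵢⱼ))`, a bilinear expression in `eᵢⱼ` and `eⱼᵢ = eᵢⱼᴴ`, to
which `sum_bilin_conj` applies. -/
theorem norm_toChoiSpace_conj {V : Mat n} (hV : V * Vᴴ = 1) (φ : Mat n →ₗ[ℂ] Mat n) :
    ‖toChoiSpace (conj Vᴴ ∘ₗ φ ∘ₗ conj V)‖ = ‖toChoiSpace φ‖ := by
  have h := sum_bilin_conj (LinearMap.mk₂ ℂ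
    (fun A B : Mat n => ((φ Bᴴ)ᴴ * φ A).trace)
    (by simp [mul_add]) (by simp) (by simp [add_mul]) (by simp)) hV
  simp only [LinearMap.mk₂_apply, conjTranspose_single, star_one] at h
  rw [← sq_eq_sq₀ (norm_nonneg _) (norm_nonneg _), ← Complex.ofReal_inj, norm_sq_toChoiSpace,
    norm_sq_toChoiSpace, ← h]
  refine Finset.sum_congr rfl fun i _ => Finset.sum_congr rfl fun j _ => ?_
  have h1 : (conj V (single j i 1))ᴴ = conj V (single i j (1 : ℂ)) := by
    simp [conj_apply, mul_assoc]
  have h2 : ∀ Z : Mat n, V * (Vᴴ * Z) = Z := fun Z => by rw [← mul_assoc, hV, one_mul]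
  rw [h1]
  generalize hZ : conj V (single i j (1 : ℂ)) = Z
  simp only [LinearMap.comp_apply, hZ, conj_apply Vᴴ, conjTranspose_mul,
    conjTranspose_conjTranspose, mul_assoc, h2]
  rw [trace_mul_comm]
  simp only [mul_assoc, hV, mul_one]

/-- If a covariant map differs from a completely copositive one by a conditionally completely
positive one, then the completely copositive map can be taken covariant. -/
theorem exists_covariant_isCoCP {G : Type*} [Group G]
    {U : G →* unitaryGroup (Fin n) ℂ} {L φ : Mat n →ₗ[ℂ] Mat n} (hLU : IsCovariant U L)
    (hφ : IsCoCP φ) (hpos : ∀ X : Mat n, X.trace = 0 → 0 ≤ choiForm (L - φ) X X) :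
    ∃ ψ : Mat n →ₗ[ℂ] Mat n, IsCoCP ψ ∧ IsCovariant U ψ ∧
      ∀ X : Mat n, X.trace = 0 → 0 ≤ choiForm (L - ψ) X X := by
  let S : Set (ChoiSpace n) := {x | IsCoCP (ofChoiSpace x) ∧
    ∀ X : Mat n, X.trace = 0 → 0 ≤ choiForm (L - ofChoiSpace x) X X}
  have hclosed : IsClosed S := by
    rw [← isSeqClosed_iff_isClosed]
    intro x y hx hxy
    have h1 : ∀ A, Tendsto (fun m => ofChoiSpace (x m) A) atTop (𝓝 (ofChoiSpace y A)) :=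
      fun A => ((continuous_ofChoiSpace_apply A).tendsto y).comp hxy
    refine ⟨isCoCP_of_tendsto (fun m => (hx m).1) h1, fun X hX => ?_⟩
    exact ge_of_tendsto' (tendsto_choiForm (φ := fun m => L - ofChoiSpace (x m))
      (fun A => (h1 A).const_sub (L A)) X X) fun m => (hx m).2 X hX
  have hmid : ∀ x ∈ S, ∀ y ∈ S, (1 / 2 : ℂ) • (x + y) ∈ S := by
    intro x hx y hy
    have hhalf : (1 / 2 : ℂ) = ((1 / 2 : ℝ) : ℂ) := by norm_num
    refine ⟨?_, fun X hX => ?_⟩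
    · rw [ofChoiSpace_smul, ofChoiSpace_add, hhalf]
      exact (hx.1.add hy.1).smul (by norm_num)
    · have h1 : L - ofChoiSpace ((1 / 2 : ℂ) • (x + y))
          = ((1 / 2 : ℝ) : ℂ) • ((L - ofChoiSpace x) + (L - ofChoiSpace y)) := by
        rw [ofChoiSpace_smul, ofChoiSpace_add, ← hhalf]
        module
      rw [h1, choiForm_smul_map, choiForm_add_map]
      exact mul_nonneg (by exact_mod_cast (by norm_num : (0 : ℝ) ≤ 1 / 2))
        (add_nonneg (hx.2 X hX) (hy.2 X hX))
  obtain ⟨x, hx, hmin⟩ := exists_unique_minimal_norm hclosed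
    ⟨toChoiSpace φ, by simpa [S, ofChoiSpace_toChoiSpace] using ⟨hφ, hpos⟩⟩ hmid
  refine ⟨ofChoiSpace x, hx.1, isCovariant_iff.mpr fun g => ?_, hx.2⟩
  set V : Mat n := (U g : Mat n) with hVdef
  have hV : V * Vᴴ = 1 := unitary_mul_conjTranspose (U g)
  have hV' : Vᴴ * V = 1 := unitary_conjTranspose_mul (U g)
  have hcc : ∀ A, conj V (conj Vᴴ A) = A := fun A => by
    rw [conj_apply, conj_apply, conjTranspose_conjTranspose, ← mul_assoc, ← mul_assoc, hV,
      one_mul, mul_assoc, hV, mul_one]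
  have hcc' : ∀ A, conj Vᴴ (conj V A) = A := fun A => by
    rw [conj_apply, conj_apply, conjTranspose_conjTranspose, ← mul_assoc, ← mul_assoc, hV',
      one_mul, mul_assoc, hV', mul_one]
  have hL : L = conj Vᴴ ∘ₗ L ∘ₗ conj V := by
    rw [isCovariant_iff.mp hLU g]
    ext1 A
    exact (hcc' _).symm
  -- The rotated map is again admissible, because `L` is invariant and conjugation keeps matrices
  -- traceless; having the same norm, it equals the minimizer.
  have hmem : toChoiSpace (conj Vᴴ ∘ₗ ofChoiSpace x ∘ₗ conj V) ∈ S := by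
    simp only [S, Set.mem_ofPred_eq, ofChoiSpace_toChoiSpace]
    refine ⟨(isCP_conj _).comp_isCoCP (hx.1.comp_isCP (isCP_conj _)), fun X hX => ?_⟩
    have h1 : L - conj Vᴴ ∘ₗ ofChoiSpace x ∘ₗ conj V
        = conj Vᴴ ∘ₗ (L - ofChoiSpace x) ∘ₗ conj V := by
      conv_lhs => rw [hL]
      rw [LinearMap.sub_comp, LinearMap.comp_sub]
    rw [h1, choiForm_conj hV]
    refine hx.2 _ ?_
    rw [conj_apply, trace_mul_comm, ← mul_assoc, hV', one_mul, hX]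
  have heq := congrArg ofChoiSpace
    (hmin _ hmem (by rw [norm_toChoiSpace_conj hV, toChoiSpace_ofChoiSpace]))
  rw [ofChoiSpace_toChoiSpace] at heq
  ext1 A
  conv_rhs => rw [← heq]
  exact (hcc _).symm

/-! ### The generator at first order. -/

/-- A tangent direction at the identity to the cone of decomposable maps is the sum of a
conditionally completely positive map and a completely copositive one. -/
theorem exists_isCoCP_of_tendsto (hn : 2 ≤ n) {D : ℕ → Mat n →ₗ[ℂ] Mat n} {c : ℕ → ℝ}
    {L : Mat n →ₗ[ℂ] Mat n} (hD : ∀ m, IsDecomposable (D m)) (hc : ∀ m, 0 ≤ c m)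
    (hL : ∀ A, Tendsto (fun m => ((c m : ℂ) • (D m - LinearMap.id) : Mat n →ₗ[ℂ] Mat n) A) atTop (𝓝 (L A))) :
    ∃ φ : Mat n →ₗ[ℂ] Mat n, IsCoCP φ ∧
      ∀ X : Mat n, X.trace = 0 → 0 ≤ choiForm (L - φ) X X := by
  choose P Q hP hQ hPQ using hD
  obtain ⟨κ, hκ⟩ := (tendsto_defect hL).bddAbove_range
  have hcQ : ∀ m, IsCoCP ((c m : ℂ) • Q m) := fun m => (hQ m).smul (hc m)
  -- The defects of `c (D - id)` converge, hence are bounded, and equal `c defect P + c defect Q`.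
  -- The first term is nonnegative, so the second bounds the Choi traces of the transposed `c Q`.
  obtain ⟨R, s, hs, hR⟩ := exists_subseq_tendsto_of_isCP
    (φ := fun m => transposition n ∘ₗ ((c m : ℂ) • Q m)) hcQ (κ := κ) fun m => by
      have h1 := hκ ⟨m, rfl⟩
      have h2 := (hcQ m).trace_choi_le_defect hn
      have h3 := mul_nonneg (hc m) (hP m).defect_nonneg
      have h4 : D m - LinearMap.id = P m + Q m + ((-1 : ℝ) : ℂ) • LinearMap.id := by
        rw [hPQ]
        push_cast
        module
      simp only [h4, defect_smul, defect_add, defect_id, mul_zero, add_zero] at h1 h2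
      linarith
  have hRQ : ∀ A, Tendsto (fun k => ((c (s k) : ℂ) • Q (s k)) A) atTop
      (𝓝 ((transposition n ∘ₗ R) A)) := fun A =>
    ((continuous_id.matrix_transpose).tendsto (R A)).comp (hR A)
  refine ⟨transposition n ∘ₗ R, isCoCP_of_tendsto (fun k => hcQ (s k)) hRQ, fun X hX => ?_⟩
  have hlim : ∀ A, Tendsto
      (fun k => ((c (s k) : ℂ) • (P (s k) - LinearMap.id) : Mat n →ₗ[ℂ] Mat n) A) atTop
      (𝓝 ((L - transposition n ∘ₗ R) A)) := fun A => by
    refine (((hL A).comp hs.tendsto_atTop).sub (hRQ A)).congr fun k => ?_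
    simp only [Function.comp_apply, hPQ, LinearMap.smul_apply, LinearMap.sub_apply,
      LinearMap.add_apply]
    module
  refine ge_of_tendsto' (tendsto_choiForm hlim X X) fun k => ?_
  -- The identity contributes `|tr X|² = 0`; only the completely positive part remains.
  rw [choiForm_smul_map, choiForm_sub_map, choiForm_id, hX, mul_zero, sub_zero]
  exact mul_nonneg (by exact_mod_cast hc (s k)) ((isCP_iff_choiForm.mp (hP (s k))).2 X)

theorem isHermitianPreserving_of_tendsto {φ : ℕ → Mat n →ₗ[ℂ] Mat n} {ψ : Mat n →ₗ[ℂ] Mat n}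
    (hφ : ∀ m, IsHermitianPreserving (φ m))
    (h : ∀ A, Tendsto (fun m => φ m A) atTop (𝓝 (ψ A))) : IsHermitianPreserving ψ := fun A => by
  refine tendsto_nhds_unique (h Aᴴ) ?_
  simp only [(hφ _).eq]
  exact ((continuous_id.matrix_conjTranspose).tendsto (ψ A)).comp (h A)

theorem isCovariant_of_tendsto {G : Type*} [Group G] {U : G →* unitaryGroup (Fin n) ℂ}
    {φ : ℕ → Mat n →ₗ[ℂ] Mat n} {ψ : Mat n →ₗ[ℂ] Mat n} (hφ : ∀ m, IsCovariant U (φ m))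
    (h : ∀ A, Tendsto (fun m => φ m A) atTop (𝓝 (ψ A))) : IsCovariant U ψ := fun g A => by
  refine tendsto_nhds_unique (h _) ?_
  simp only [hφ _ g A]
  have hc : Continuous fun M : Mat n => (U g : Mat n) * M * (U g : Mat n)ᴴ :=
    (continuous_const.matrix_mul continuous_id).matrix_mul continuous_const
  exact (hc.tendsto (ψ A)).comp (h A)

/-! ### Exponentials. -/

section BanachAlgebra

variable {𝔸 : Type*} [NormedRing 𝔸] [NormedAlgebra ℂ 𝔸] [CompleteSpace 𝔸]

theorem tendsto_ofReal_one_div_add_atTop :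
    Tendsto (fun m : ℕ => ((1 / (m + 1 : ℝ) : ℝ) : ℂ)) atTop (𝓝 0) := by
  have h := (Complex.continuous_ofReal.tendsto 0).comp
    (tendsto_one_div_add_atTop_nhds_zero_nat (𝕜 := ℝ))
  rwa [Complex.ofReal_zero] at h

theorem tendsto_exp_slope (X : 𝔸) :
    Tendsto (fun m : ℕ => ((m + 1 : ℝ) : ℂ) •
      (NormedSpace.exp (((1 / (m + 1 : ℝ) : ℝ) : ℂ) • X) - 1)) atTop (𝓝 X) := by
  have h := hasDerivAt_exp_smul_const' (𝕂 := ℂ) X (0 : ℂ)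
  rw [hasDerivAt_iff_tendsto_slope_zero] at h
  have ht : Tendsto (fun m : ℕ => (((1 / (m + 1 : ℝ) : ℝ)) : ℂ)) atTop (𝓝[≠] 0) := by
    refine tendsto_nhdsWithin_iff.mpr
      ⟨tendsto_ofReal_one_div_add_atTop, Eventually.of_forall fun m => ?_⟩
    have : (1 / (m + 1 : ℝ) : ℝ) ≠ 0 := by positivity
    exact Complex.ofReal_ne_zero.mpr this
  have h2 := h.comp ht
  simp only [zero_smul, NormedSpace.exp_zero, mul_one] at h2
  refine h2.congr fun m => ?_
  simp

theorem exp_add_algebraMap (X : 𝔸) (c : ℂ) :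
    NormedSpace.exp (X + algebraMap ℂ 𝔸 c) = Complex.exp c • NormedSpace.exp X := by
  let _ : NormedAlgebra ℚ 𝔸 := NormedAlgebra.restrictScalars ℚ ℂ 𝔸
  rw [NormedSpace.exp_add_of_commute (Algebra.commute_algebraMap_right _ _),
    ← NormedSpace.algebraMap_exp_comm, ← Complex.exp_eq_exp_ℂ, ← Algebra.commutes,
    ← Algebra.smul_def]

theorem tendsto_exp_add_smul (X Y : 𝔸) :
    Tendsto (fun m : ℕ => NormedSpace.exp (X + ((1 / (m + 1 : ℝ) : ℝ) : ℂ) • Y)) atTop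
      (𝓝 (NormedSpace.exp X)) := by
  let _ : NormedAlgebra ℚ 𝔸 := NormedAlgebra.restrictScalars ℚ ℂ 𝔸
  have hc : Continuous fun z : ℂ => NormedSpace.exp (X + z • Y) :=
    NormedSpace.exp_continuous.comp (by fun_prop)
  have h := (hc.tendsto 0).comp tendsto_ofReal_one_div_add_atTop
  rwa [zero_smul, add_zero] at h

end BanachAlgebra

section Exponential

open scoped Matrix.Norms.L2Operator

theorem expSemigroup_apply (L : Mat n →ₗ[ℂ] Mat n) (t : ℝ) (A : Mat n) :
    expSemigroup L t A
      = (NormedSpace.exp ((t : ℂ) • LinearMap.toContinuousLinearMap L) : Mat n →L[ℂ] Mat n) A :=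
  rfl

theorem hasSum_expSemigroup (L : Mat n →ₗ[ℂ] Mat n) (t : ℝ) (A : Mat n) :
    HasSum (fun k : ℕ => ((((k.factorial : ℝ)⁻¹ * t ^ k : ℝ) : ℂ) • L ^ k) A)
      (expSemigroup L t A) := by
  have h := NormedSpace.exp_series_hasSum_exp' (𝕂 := ℂ)
    ((t : ℂ) • LinearMap.toContinuousLinearMap L : Mat n →L[ℂ] Mat n)
  have h2 := h.mapL (ContinuousLinearMap.apply ℂ (Mat n) A)
  rw [expSemigroup_apply]
  refine (congrArg (fun f => HasSum f _) (funext fun k => ?_)).mpr h2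
  have h3 : ∀ (M : Mat n →ₗ[ℂ] Mat n) (k : ℕ) (B : Mat n),
      (LinearMap.toContinuousLinearMap M ^ k : Mat n →L[ℂ] Mat n) B = (M ^ k) B := fun M k => by
    induction k with
    | zero => intro B; rfl
    | succ k ih => intro B; rw [pow_succ, pow_succ]; exact ih _
  have h4 := h3 ((t : ℂ) • L) k A
  rw [smul_pow, LinearMap.smul_apply] at h4
  rw [LinearMap.smul_apply]
  push_cast
  rw [mul_smul, ← h4]
  rfl

theorem expSemigroup_trace {L : Mat n →ₗ[ℂ] Mat n} (hL : ∀ A, (L A).trace = 0) (t : ℝ) :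
    IsTracePreserving (expSemigroup L t) := fun A => by
  have h := (hasSum_expSemigroup L t A).map (traceAddMonoidHom (Fin n) ℂ)
    continuous_id.matrix_trace
  have h0 := hasSum_single (f := (traceAddMonoidHom (Fin n) ℂ) ∘ fun k : ℕ =>
    ((((k.factorial : ℝ)⁻¹ * t ^ k : ℝ) : ℂ) • L ^ k) A) 0 fun k hk => by
      obtain ⟨k, rfl⟩ := Nat.exists_eq_succ_of_ne_zero hk
      simp [pow_succ', hL]
  refine (h.unique h0).trans ?_
  simp

theorem expSemigroup_covariant {G : Type*} [Group G] {U : G →* unitaryGroup (Fin n) ℂ}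
    {L : Mat n →ₗ[ℂ] Mat n} (hL : IsCovariant U L) (t : ℝ) :
    IsCovariant U (expSemigroup L t) := by
  have hk : ∀ k : ℕ, IsCovariant U (L ^ k) := fun k => by
    induction k with
    | zero => exact fun g A => rfl
    | succ k ih => exact fun g A => by simp only [pow_succ', Module.End.mul_apply, ih g A, hL g _]
  intro g A
  have hc : Continuous fun M : Mat n => (U g : Mat n) * M * (U g : Mat n)ᴴ :=
    (continuous_const.matrix_mul continuous_id).matrix_mul continuous_const
  have h := (hasSum_expSemigroup L t A).map
    (LinearMap.toAddMonoidHom (conj (U g : Mat n))) (hc.congr fun M => (conj_apply _ M).symm)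
  refine (hasSum_expSemigroup L t _).unique ?_
  convert h using 1
  · ext1 k
    simp [hk k g A, conj_apply]
  · simp [conj_apply]

theorem tendsto_expSemigroup_slope (L : Mat n →ₗ[ℂ] Mat n) (A : Mat n) :
    Tendsto (fun m : ℕ => (((m + 1 : ℝ) : ℂ) •
      (expSemigroup L (1 / (m + 1 : ℝ)) - LinearMap.id) : Mat n →ₗ[ℂ] Mat n) A) atTop
      (𝓝 (L A)) :=
  ((ContinuousLinearMap.apply ℂ (Mat n) A).continuous.tendsto _).comp
    (tendsto_exp_slope (LinearMap.toContinuousLinearMap L : Mat n →L[ℂ] Mat n))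

/-- The identity is central, so its exponential factors out as a positive scalar. -/
theorem expSemigroup_sub_smul_id (L : Mat n →ₗ[ℂ] Mat n) (c t : ℝ) :
    expSemigroup (L - (c : ℂ) • LinearMap.id) t
      = ((Real.exp (-(c * t)) : ℝ) : ℂ) • expSemigroup L t := by
  ext1 A
  have h1 : (t : ℂ) • LinearMap.toContinuousLinearMap (L - (c : ℂ) • LinearMap.id)
      = (t : ℂ) • LinearMap.toContinuousLinearMap L
        + algebraMap ℂ (Mat n →L[ℂ] Mat n) ((-(c * t) : ℝ) : ℂ) := by
    ext1 B
    simp [Algebra.algebraMap_eq_smul_one]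
    module
  have h2 := exp_add_algebraMap
    ((t : ℂ) • LinearMap.toContinuousLinearMap L : Mat n →L[ℂ] Mat n) ((-(c * t) : ℝ) : ℂ)
  rw [← h1, ← Complex.ofReal_exp] at h2
  exact congrArg (fun T : Mat n →L[ℂ] Mat n => T A) h2

theorem tendsto_expSemigroup (L M : Mat n →ₗ[ℂ] Mat n) (t : ℝ) (A : Mat n) :
    Tendsto (fun m : ℕ => expSemigroup (L + ((1 / (m + 1 : ℝ) : ℝ) : ℂ) • M) t A) atTop
      (𝓝 (expSemigroup L t A)) := by
  have h := ((ContinuousLinearMap.apply ℂ (Mat n) A).continuous.tendsto _).comp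
    (tendsto_exp_add_smul ((t : ℂ) • LinearMap.toContinuousLinearMap L : Mat n →L[ℂ] Mat n)
      ((t : ℂ) • LinearMap.toContinuousLinearMap M))
  refine h.congr fun m => ?_
  rw [expSemigroup_apply, map_add, map_smul, smul_add, smul_comm (t : ℂ)]
  rfl

end Exponential

/-! ### Decomposability of the semigroup. -/

theorem IsDecomposable.expSemigroup {L : Mat n →ₗ[ℂ] Mat n} (hL : IsDecomposable L) {t : ℝ}
    (ht : 0 ≤ t) : IsDecomposable (expSemigroup L t) := by
  refine isDecomposable_of_tendsto (φ := fun m => ∑ k ∈ Finset.range m,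
    (((k.factorial : ℝ)⁻¹ * t ^ k : ℝ) : ℂ) • L ^ k) (fun m => ?_) fun A => ?_
  · exact IsDecomposable.sum _ fun k _ => (hL.pow k).smul (by positivity)
  · simpa only [LinearMap.sum_apply] using (hasSum_expSemigroup L t A).tendsto_sum_nat

/-- The drift is the first-order term of `conj (1 + s D) = id + s (D · + · Dᴴ) + s² conj D`. Adding
`s conj D` to the generator thus makes it decomposable minus `s⁻¹ id`; then `s → 0`. -/
theorem isDecomposable_expSemigroup_of_drift {φ : Mat n →ₗ[ℂ] Mat n} (hφ : IsDecomposable φ)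
    (D : Mat n) {t : ℝ} (ht : 0 ≤ t) :
    IsDecomposable (expSemigroup
      (φ + (LinearMap.mulLeft ℂ D + LinearMap.mulRight ℂ Dᴴ)) t) := by
  refine isDecomposable_of_tendsto (fun m => ?_) fun A => tendsto_expSemigroup _ (conj D) t A
  set s : ℝ := 1 / (m + 1 : ℝ) with hs
  have hs0 : (0 : ℝ) < s := by positivity
  have hsc : (s : ℂ) ≠ 0 := by exact_mod_cast hs0.ne'
  have h : φ + (LinearMap.mulLeft ℂ D + LinearMap.mulRight ℂ Dᴴ) + (s : ℂ) • conj D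
      = (φ + ((s⁻¹ : ℝ) : ℂ) • conj (1 + (s : ℂ) • D)) - ((s⁻¹ : ℝ) : ℂ) • LinearMap.id := by
    ext1 A
    simp only [LinearMap.add_apply, LinearMap.sub_apply, LinearMap.smul_apply, conj_apply,
      LinearMap.mulLeft_apply, LinearMap.mulRight_apply, LinearMap.id_apply, conjTranspose_add,
      conjTranspose_smul, conjTranspose_one, add_mul, mul_add, one_mul, mul_one,
      Complex.star_def, Complex.conj_ofReal, smul_mul_assoc, mul_smul_comm, smul_add, smul_smul,
      Complex.ofReal_inv, inv_mul_cancel₀ hsc, one_smul]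
    rw [← mul_assoc, inv_mul_cancel₀ hsc, one_mul]
    abel
  rw [h, expSemigroup_sub_smul_id]
  exact ((hφ.add ((isCP_conj _).isDecomposable.smul (inv_nonneg.mpr hs0.le))).expSemigroup
    ht).smul (Real.exp_pos _).le

/-! ### The two implications. -/

variable {G : Type*} [Group G] {U : G →* unitaryGroup (Fin n) ℂ}
  {L : Mat n →ₗ[ℂ] Mat n}

theorem exists_generatorForm
    (h : ∀ t : ℝ, 0 ≤ t → IsDecomposable (expSemigroup L t) ∧ IsTracePreserving (expSemigroup L t))
    (hU : ∀ t : ℝ, 0 ≤ t → IsCovariant U (expSemigroup L t)) :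
    ∃ (H : Mat n) (φ : Mat n →ₗ[ℂ] Mat n),
      H.IsHermitian ∧ H ∈ Set.centralizer (Set.range fun g : G => (U g : Mat n)) ∧
      IsDecomposable φ ∧ IsCovariant U φ ∧ HasGeneratorForm L H φ := by
  have hc : ∀ m : ℕ, (0 : ℝ) ≤ m + 1 := fun m => by positivity
  have ht : ∀ m : ℕ, (0 : ℝ) ≤ 1 / (m + 1 : ℝ) := fun m => by positivity
  have hlim := tendsto_expSemigroup_slope L
  have hLtr : ∀ A, (L A).trace = 0 := fun A => by
    refine tendsto_nhds_unique
      (((continuous_id.matrix_trace).tendsto (L A)).comp (hlim A)) ?_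
    refine tendsto_const_nhds.congr fun m => ?_
    have h1 := (h _ (ht m)).2 A
    simp only [Function.comp_apply, LinearMap.smul_apply, LinearMap.sub_apply, trace_smul,
      LinearMap.id_apply, id_eq, trace_sub, h1, sub_self, smul_zero]
  rcases Nat.lt_or_ge n 2 with hn | hn
  -- For `n ≤ 1` the defect bound is unavailable, but a map with traceless values is zero.
  · have hL : L = 0 := by
      ext1 A
      have hA := hLtr A
      interval_cases n
      · exact Subsingleton.elim _ _
      · ext i j
        fin_cases i
        fin_cases j
        simpa [trace] using hA
    subst hL
    refine ⟨0, 0, isHermitian_zero, Set.zero_mem_centralizer, IsCP.zero.isDecomposable,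
      fun g A => by simp, fun A => ?_⟩
    have h0 : traceDual (0 : Mat n →ₗ[ℂ] Mat n) 1 = 0 := by
      ext
      simp [traceDual]
    simp [h0]
  · have : NeZero n := ⟨by omega⟩
    have hLU : IsCovariant U L := isCovariant_of_tendsto (fun m g A => by
      simp only [LinearMap.smul_apply, LinearMap.sub_apply, LinearMap.id_apply,
        hU _ (ht m) g A, mul_smul_comm, smul_mul_assoc, mul_sub, sub_mul]) hlim
    have hLH : IsHermitianPreserving L := isHermitianPreserving_of_tendsto (fun m A => by
      have h1 := ((h _ (ht m)).1.isHermitianPreserving.sub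
        IsCP.id.isHermitianPreserving).eq A
      rw [LinearMap.smul_apply, h1, LinearMap.smul_apply, conjTranspose_smul, Complex.star_def,
        Complex.conj_ofReal]) hlim
    obtain ⟨φ, hφ, hpos⟩ := exists_isCoCP_of_tendsto hn (fun m => (h _ (ht m)).1) hc hlim
    obtain ⟨ψ, hψ, hψU, hψpos⟩ := exists_covariant_isCoCP hLU hφ hpos
    exact exists_generatorForm_of_isCoCP hLH hLU hLtr hψ hψU hψpos

theorem traceDual_one_isHermitian {φ : Mat n →ₗ[ℂ] Mat n} (hφ : IsHermitianPreserving φ) :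
    (traceDual φ 1)ᴴ = traceDual φ 1 := by
  ext i j
  simp only [traceDual, conjTranspose_apply, LinearMap.coe_mk, AddHom.coe_mk, of_apply, one_mul]
  rw [← trace_conjTranspose, ← hφ.eq, conjTranspose_single, star_one]

/-- Tested against `X`, conjugation moves into the argument of `φ`, where covariance and invariance
of the trace remove it. -/
theorem traceDual_one_commute {φ : Mat n →ₗ[ℂ] Mat n} (hφ : IsCovariant U φ) (g : G) :
    (U g : Mat n) * traceDual φ 1 = traceDual φ 1 * (U g : Mat n) := by
  have hV := unitary_conjTranspose_mul (U g)
  rw [← conj_eq_iff_commute, ← sub_eq_zero]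
  refine eq_zero_of_trace_mul fun X => ?_
  have h1 : (conj (U g : Mat n) (traceDual φ 1) * X).trace
      = (traceDual φ 1 * ((U g : Mat n)ᴴ * X * (U g : Mat n))).trace := by
    rw [conj_apply, mul_assoc, mul_assoc, trace_mul_comm]
    simp only [mul_assoc]
  have h2 := hφ g ((U g : Mat n)ᴴ * X * (U g : Mat n))
  have h3 : (U g : Mat n) * ((U g : Mat n)ᴴ * X * (U g : Mat n)) * (U g : Mat n)ᴴ = X := by
    have hV' := unitary_mul_conjTranspose (U g)
    rw [← mul_assoc, ← mul_assoc, hV', one_mul, mul_assoc, hV', mul_one]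
  rw [h3] at h2
  rw [sub_mul, trace_sub, h1, trace_traceDual_mul, trace_traceDual_mul, one_mul, one_mul, h2,
    trace_mul_comm _ (U g : Mat n)ᴴ, ← mul_assoc, hV, one_mul, sub_self]

theorem expSemigroup_of_generatorForm {H : Mat n} {φ : Mat n →ₗ[ℂ] Mat n} (hH : H.IsHermitian)
    (hHU : H ∈ Set.centralizer (Set.range fun g : G => (U g : Mat n))) (hφ : IsDecomposable φ)
    (hφU : IsCovariant U φ) (hL : HasGeneratorForm L H φ) :
    (∀ t : ℝ, 0 ≤ t → IsDecomposable (expSemigroup L t) ∧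
        IsTracePreserving (expSemigroup L t)) ∧
      ∀ t : ℝ, 0 ≤ t → IsCovariant U (expSemigroup L t) := by
  set T := traceDual φ 1 with hT
  have hTH : Tᴴ = T := traceDual_one_isHermitian hφ.isHermitianPreserving
  -- As `H` and `T` are Hermitian, `D A + A Dᴴ` equals `-i[H, A] - ½{T, A}`.
  set D : Mat n := -(Complex.I • H) - (1 / 2 : ℂ) • T with hD
  have hDH : Dᴴ = Complex.I • H - (1 / 2 : ℂ) • T := by
    rw [hD, conjTranspose_sub, conjTranspose_neg, conjTranspose_smul, conjTranspose_smul, hTH,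
      hH.eq]
    simp
  have hLD : L = φ + (LinearMap.mulLeft ℂ D + LinearMap.mulRight ℂ Dᴴ) := by
    ext1 A
    rw [hL A, hDH]
    simp only [LinearMap.add_apply, LinearMap.mulLeft_apply, LinearMap.mulRight_apply, hD,
      sub_mul, mul_sub, neg_mul, smul_mul_assoc, mul_smul_comm, ← hT]
    module
  have hLtr : ∀ A, (L A).trace = 0 := fun A => by
    have h1 := trace_traceDual_mul φ 1 A
    rw [one_mul, ← hT] at h1
    rw [hL A, ← hT]
    simp only [trace_sub, trace_add, trace_smul, ← h1, trace_mul_comm A]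
    simp only [smul_eq_mul]
    ring
  have hDU : ∀ g, (U g : Mat n) * D = D * (U g : Mat n) := fun g => by
    have h1 : (U g : Mat n) * H = H * (U g : Mat n) := hHU _ ⟨g, rfl⟩
    rw [hD, mul_sub, sub_mul, mul_neg, neg_mul, mul_smul_comm, mul_smul_comm, smul_mul_assoc,
      smul_mul_assoc, h1, hT, traceDual_one_commute hφU g]
  have hLU : IsCovariant U L := by
    rw [hLD]
    exact hφU.add (isCovariant_mulLeft_add_mulRight hDU fun g => commute_conjTranspose (hDU g))
  refine ⟨fun t ht => ⟨?_, expSemigroup_trace hLtr t⟩, fun t _ => expSemigroup_covariant hLU t⟩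
  rw [hLD]
  exact isDecomposable_expSemigroup_of_drift hφ D ht

end DecQuantum

theorem mainTheorem9 {E : Type*} [NormedAddCommGroup E] [NormedSpace ℝ E] [FiniteDimensional ℝ E]
    {G : Type*} [TopologicalSpace G] [ChartedSpace E G] [Group G] [LieGroup 𝓘(ℝ, E) ∞ G]
    [CompactSpace G]
    (n : ℕ) (U : G →* Matrix.unitaryGroup (Fin n) ℂ) (hU : Continuous U)
    (L : DecQuantum.Mat n →ₗ[ℂ] DecQuantum.Mat n) :
    ((∀ t : ℝ, 0 ≤ t → DecQuantum.IsDecomposable (DecQuantum.expSemigroup L t) ∧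
          DecQuantum.IsTracePreserving (DecQuantum.expSemigroup L t)) ∧
        (∀ t : ℝ, 0 ≤ t → DecQuantum.IsCovariant U (DecQuantum.expSemigroup L t))) ↔
      ∃ (H : DecQuantum.Mat n) (φ : DecQuantum.Mat n →ₗ[ℂ] DecQuantum.Mat n),
        H.IsHermitian ∧ H ∈ Set.centralizer (Set.range fun g : G => (U g : DecQuantum.Mat n)) ∧
        DecQuantum.IsDecomposable φ ∧ DecQuantum.IsCovariant U φ ∧
        DecQuantum.HasGeneratorForm L H φ := by
  exact ⟨fun h => DecQuantum.exists_generatorForm h.1 h.2,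
    fun ⟨_, _, hH, hHU, hφ, hφU, hL⟩ =>
      DecQuantum.expSemigroup_of_generatorForm hH hHU hφ hφU hL⟩
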